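/- Let $2<p<\infty$, let $L_p(\mathbb{R})$ be the real or complex Lebesgue space, let $f\in L_p(\mathbb{R})$ and $\Lambda\subseteq\mathbb{R}$. For $\lambda\in\mathbb{R}$ put $(T_\lambda f)(x)=f(x-\lambda)$, and let $X_p(f,\Lambda)$ be the closed linear span of $\{T_\lambda f:\lambda\in\Lambda\}$ in $L_p(\mathbb{R})$. Suppose that $(T_\lambda f)_{\lambda\in\Lambda}$ is an unconditional (Schauder) basis of $X_p(f,\Lambda)$ and that $X_p(f,\Lambda)$ is complemented in $L_p(\mathbb{R})$, i.e. it is the range of a bounded linear projection on $L_p(\mathbb{R})$. Then $(T_\lambda f)_{\lambda\in\Lambda}$ is equivalent to the unit vector basis of $\ell_p(\Lambda)$ (that is, of $\ell_p$ when $\Lambda$ is infinite): there are constants $c,C\in(0,\infty)$ such that for every finitely supported scalar family $(a_\lambda)_{\lambda\in\Lambda}$, $$c\Big(\sum_{\lambda\in\Lambda}|a_\lambda|^p\Big)^{1/p}\le\Big\|\sum_{\lambda\in\Lambda}a_\lambda T_\lambda f\Big\|_p\le C\Big(\sum_{\lambda\in\Lambda}|a_\lambda|^p\Big)^{1/p}.$$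 -/

import Mathlib

open MeasureTheory
open scoped ENNReal

/-- The translation operator on `L_p(ℝ)`: `(T_t f)(x) = f (x - t)`. -/
noncomputable def lpTranslate {𝕜 : Type*} [RCLike 𝕜] {p : ℝ≥0∞} (t : ℝ)
    (f : Lp 𝕜 p (volume : Measure ℝ)) : Lp 𝕜 p (volume : Measure ℝ) :=
  Lp.compMeasurePreserving (fun x : ℝ => x - t)
    (measurePreserving_sub_right (volume : Measure ℝ) t) f

/-- `X_p(f, Λ)`: the closed linear span in `L_p(ℝ)` of the translates `T_t f`, `t ∈ Λ`. -/
noncomputable def translateSpan {𝕜 : Type*} [RCLike 𝕜] {p : ℝ≥0∞} [Fact (1 ≤ p)]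
    (f : Lp 𝕜 p (volume : Measure ℝ)) (Λ : Set ℝ) :
    Submodule 𝕜 (Lp 𝕜 p (volume : Measure ℝ)) :=
  (Submodule.span 𝕜 (Set.range fun t : Λ => lpTranslate (t : ℝ) f)).topologicalClosure

/-- The family `x` is an unconditional (Schauder) basis of the subspace `X`: its members are the
vectors of an unconditional Schauder basis of `X`. -/
def IsUnconditionalBasisOf {ι 𝕜 E : Type*} [RCLike 𝕜] [NormedAddCommGroup E] [NormedSpace 𝕜 E]
    (x : ι → E) (X : Submodule 𝕜 E) : Prop :=
  ∃ b : UnconditionalSchauderBasis ι 𝕜 X, ∀ i, (b.basis i : E) = x i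

/-- Equivalence of families: the norms of finite linear combinations with the same coefficients
are comparable, up to constants independent of the coefficients. -/
def EquivalentFamilies (𝕜 : Type*) {ι E F : Type*} [RCLike 𝕜]
    [NormedAddCommGroup E] [NormedSpace 𝕜 E] [NormedAddCommGroup F] [NormedSpace 𝕜 F]
    (x : ι → E) (y : ι → F) : Prop :=
  ∃ c C : ℝ, 0 < c ∧ 0 < C ∧ ∀ (s : Finset ι) (a : ι → 𝕜),
    c * ‖∑ i ∈ s, a i • y i‖ ≤ ‖∑ i ∈ s, a i • x i‖ ∧
      ‖∑ i ∈ s, a i • x i‖ ≤ C * ‖∑ i ∈ s, a i • y i‖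

open Classical in
/-- The unit vector basis of `ℓ_p(ι)`. -/
noncomputable def unitVector (𝕜 : Type*) [RCLike 𝕜] {ι : Type*} (p : ℝ≥0∞) (i : ι) :
    lp (fun _ : ι => 𝕜) p :=
  lp.single p i (1 : 𝕜)

/-!
Write `x_t` for the translate `T_t f` and `‖·‖_p` for both the `L_p` and the `ℓ_p` norm.

*Lower estimate.* For `p ≥ 2`, Clarkson's inequality provides signs with
`∑ ‖a_t x_t‖ ^ p ≤ ‖∑ ε_t a_t x_t‖ ^ p` (`Lp.exists_signs_sum_rpow_le`), unconditionality removes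
the signs, and all `x_t` have the same norm.

*Upper estimate.* The coordinate functionals are uniformly bounded, so the `x_t` are uniformly
apart in norm; since translation is continuous in `L_p`, the set `Λ` is uniformly discrete.
Let `P` be the projection and let `g` be a function of bounded support close to `f`.
The numbers `x_t^*(P (T_t g))` are then close to `x_t^*(x_t) = 1`, and after dividing `T_t g` by
them one obtains functions `y_t` of bounded norm with `x_t^*(P y_t) = 1`, supported in intervals
of a fixed length around the points `t`. As `Λ` is uniformly discrete these intervals overlap boundedly often,
so that `‖∑ a_t y_t‖ ≤ C ‖a‖_p` (`Lp.norm_sum_rpow_le_of_overlap`). Finally `∑ a_t x_t` is the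
diagonal, i.e. the average over all signs `ε`, of
`∑_t ε_t x_t^*(P (∑_u ε_u a_u y_u)) x_t`, whose norm is at most a constant times
`‖∑ ε_u a_u y_u‖` by unconditionality and boundedness of `P`
(`UnconditionalSchauderBasis.exists_norm_sum_le_of_diagonal`).
-/

/-! ### Diagonals of signed double sums -/

/-- Averaging over signs isolates the diagonal of a double sum: some choice of signs makes the
full signed double sum at least as large as its diagonal part. The vector `w` carries the
induction. -/
theorem exists_signs_norm_add_diagonal_le (𝕜 : Type*) {ι E : Type*} [RCLike 𝕜]
    [NormedAddCommGroup E] [NormedSpace 𝕜 E] (c : ι → ι → E) (s : Finset ι) (w : E) :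
    ∃ ε : ι → 𝕜, (∀ i, ε i = 1 ∨ ε i = -1) ∧
      ‖w + ∑ i ∈ s, c i i‖ ≤ ‖w + ∑ i ∈ s, ∑ j ∈ s, (ε i * ε j) • c i j‖ := by
  classical
  induction s using Finset.induction_on generalizing w with
  | empty => exact ⟨fun _ => 1, fun _ => Or.inl rfl, by simp⟩
  | insert a s ha ih =>
    obtain ⟨ε, hε, h⟩ := ih (w + c a a)
    set D := w + c a a + ∑ i ∈ s, ∑ j ∈ s, (ε i * ε j) • c i j with hD
    set Y := ∑ i ∈ s, ε i • (c i a + c a i) with hY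
    have key : ∀ σ : 𝕜, σ * σ = 1 →
        w + ∑ i ∈ insert a s, ∑ j ∈ insert a s,
          (Function.update ε a σ i * Function.update ε a σ j) • c i j = D + σ • Y := by
      intro σ hσ
      have hne : ∀ i ∈ s, i ≠ a := fun i hi => ne_of_mem_of_not_mem hi ha
      simp only [Finset.sum_insert ha, Function.update_self, hσ, one_smul]
      have h1 : ∑ j ∈ s, (σ * Function.update ε a σ j) • c a j = ∑ j ∈ s, σ • ε j • c a j :=
        Finset.sum_congr rfl fun j hj => by rw [Function.update_of_ne (hne j hj), mul_smul]
      have h2 : ∑ i ∈ s, ((Function.update ε a σ i * σ) • c i a +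
          ∑ j ∈ s, (Function.update ε a σ i * Function.update ε a σ j) • c i j) =
          ∑ i ∈ s, (σ • ε i • c i a + ∑ j ∈ s, (ε i * ε j) • c i j) := by
        refine Finset.sum_congr rfl fun i hi => ?_
        rw [Function.update_of_ne (hne i hi), mul_comm, mul_smul]
        congr 1
        exact Finset.sum_congr rfl fun j hj => by rw [Function.update_of_ne (hne j hj)]
      rw [h1, h2, Finset.sum_add_distrib, hD, hY, Finset.smul_sum]
      simp only [smul_add, Finset.sum_add_distrib]
      abel
    -- `D` is the midpoint of `D + Y` and `D - Y`, so one of the two is at least as long.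
    have hmid : ‖D‖ ≤ ‖D + Y‖ ∨ ‖D‖ ≤ ‖D - Y‖ := by
      by_contra! hlt
      have h2 : (2 : 𝕜) • D = (D + Y) + (D - Y) := by rw [two_smul]; abel
      have h3 := norm_add_le (D + Y) (D - Y)
      rw [← h2, norm_smul, RCLike.norm_ofNat] at h3
      linarith
    have hw : w + ∑ i ∈ insert a s, c i i = w + c a a + ∑ i ∈ s, c i i := by
      rw [Finset.sum_insert ha, add_assoc]
    have hup : ∀ σ : 𝕜, (σ = 1 ∨ σ = -1) →
        ∀ i, Function.update ε a σ i = 1 ∨ Function.update ε a σ i = -1 := by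
      intro σ hσ i
      rcases eq_or_ne i a with rfl | hi
      · simpa using hσ
      · simpa [hi] using hε i
    rcases hmid with hm | hm
    · refine ⟨Function.update ε a 1, hup 1 (Or.inl rfl), ?_⟩
      rw [key 1 (by simp), one_smul, hw]
      exact h.trans hm
    · refine ⟨Function.update ε a (-1), hup (-1) (Or.inr rfl), ?_⟩
      rw [key (-1) (by simp), neg_one_smul, ← sub_eq_add_neg, hw]
      exact h.trans hm

/-! ### Estimates in `L_p` -/

/-- Clarkson's inequality for scalars: the parallelogram law combined with convexity and
superadditivity of `x ↦ x ^ (r / 2)`. -/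
theorem two_mul_rpow_add_rpow_le {𝕜 : Type*} [RCLike 𝕜] {r : ℝ} (hr : 2 ≤ r) (z w : 𝕜) :
    2 * (‖z‖ ^ r + ‖w‖ ^ r) ≤ ‖z + w‖ ^ r + ‖z - w‖ ^ r := by
  have hsq : ∀ x : 𝕜, ‖x‖ ^ r = (‖x‖ ^ 2) ^ (r / 2) := fun x => by
    rw [← Real.rpow_natCast, ← Real.rpow_mul (norm_nonneg _)]
    congr 1
    push_cast
    ring
  have h1 : (1 : ℝ) ≤ r / 2 := by linarith
  have hsup := Real.add_rpow_le_rpow_add (sq_nonneg ‖z‖) (sq_nonneg ‖w‖) h1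
  have hpar : ‖z + w‖ ^ 2 + ‖z - w‖ ^ 2 = 2 * (‖z‖ ^ 2 + ‖w‖ ^ 2) := by
    have := parallelogram_law_with_norm 𝕜 z w
    simpa [sq] using this
  have hconv := (convexOn_rpow h1).2 (Set.mem_Ici.2 (sq_nonneg ‖z + w‖))
    (Set.mem_Ici.2 (sq_nonneg ‖z - w‖)) (by norm_num : (0 : ℝ) ≤ 1 / 2)
    (by norm_num : (0 : ℝ) ≤ 1 / 2) (by norm_num)
  simp only [smul_eq_mul] at hconv
  have hm : 1 / 2 * ‖z + w‖ ^ 2 + 1 / 2 * ‖z - w‖ ^ 2 = ‖z‖ ^ 2 + ‖w‖ ^ 2 := by linarith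
  rw [hm] at hconv
  rw [hsq z, hsq w, hsq (z + w), hsq (z - w)]
  linarith

section LpEstimates

variable {α 𝕜 : Type*} [RCLike 𝕜] [MeasurableSpace α] {μ : Measure α} {p : ℝ≥0∞}

theorem Lp.ofReal_norm_rpow_eq_lintegral (hp0 : p ≠ 0) (hp : p ≠ ∞) (u : Lp 𝕜 p μ) :
    ENNReal.ofReal (‖u‖ ^ p.toReal) = ∫⁻ x, ENNReal.ofReal (‖u x‖ ^ p.toReal) ∂μ := by
  have hpos : 0 < p.toReal := ENNReal.toReal_pos hp0 hp
  rw [Lp.norm_def, ← ENNReal.ofReal_rpow_of_nonneg ENNReal.toReal_nonneg hpos.le,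
    ENNReal.ofReal_toReal (Lp.eLpNorm_ne_top u),
    eLpNorm_eq_lintegral_rpow_enorm_toReal hp0 hp, ← ENNReal.rpow_mul,
    one_div, inv_mul_cancel₀ hpos.ne', ENNReal.rpow_one]
  refine lintegral_congr fun x => ?_
  rw [← ENNReal.ofReal_rpow_of_nonneg (norm_nonneg _) hpos.le, ofReal_norm]

/-- Clarkson's inequality in `L_p`, `p ≥ 2`. -/
theorem Lp.two_mul_rpow_add_rpow_le [Fact (1 ≤ p)] (hp2 : 2 ≤ p) (hp : p ≠ ∞)
    (u v : Lp 𝕜 p μ) :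
    2 * (‖u‖ ^ p.toReal + ‖v‖ ^ p.toReal) ≤ ‖u + v‖ ^ p.toReal + ‖u - v‖ ^ p.toReal := by
  have hp0 : p ≠ 0 := (lt_of_lt_of_le two_pos hp2).ne'
  have hr : 2 ≤ p.toReal := by simpa using ENNReal.toReal_mono hp hp2
  rw [← ENNReal.ofReal_le_ofReal_iff (by positivity), ENNReal.ofReal_add (by positivity)
    (by positivity), ENNReal.ofReal_mul (by norm_num), ENNReal.ofReal_add (by positivity)
    (by positivity)]
  simp only [Lp.ofReal_norm_rpow_eq_lintegral hp0 hp]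
  have hmeas : ∀ w : Lp 𝕜 p μ, AEMeasurable (fun x => ENNReal.ofReal (‖w x‖ ^ p.toReal)) μ :=
    fun w => ((Lp.aestronglyMeasurable w).norm.aemeasurable.pow_const _).ennreal_ofReal
  rw [← lintegral_add_left' (hmeas u), ← lintegral_add_left' (hmeas (u + v)),
    ← lintegral_const_mul' _ _ ENNReal.ofReal_ne_top]
  refine lintegral_mono_ae ?_
  filter_upwards [Lp.coeFn_add u v, Lp.coeFn_sub u v] with x hadd hsub
  rw [hadd, hsub, Pi.add_apply, Pi.sub_apply, ← ENNReal.ofReal_add (by positivity)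
    (by positivity), ← ENNReal.ofReal_add (by positivity) (by positivity),
    ← ENNReal.ofReal_mul (by norm_num)]
  exact ENNReal.ofReal_le_ofReal (_root_.two_mul_rpow_add_rpow_le hr _ _)

/-- Cotype `p` of `L_p`, `p ≥ 2`, in the form of a single good choice of signs. -/
theorem Lp.exists_signs_sum_rpow_le [Fact (1 ≤ p)] (hp2 : 2 ≤ p) (hp : p ≠ ∞) {ι : Type*}
    (u : ι → Lp 𝕜 p μ) (s : Finset ι) :
    ∃ ε : ι → 𝕜, (∀ i, ε i = 1 ∨ ε i = -1) ∧
      ∑ i ∈ s, ‖u i‖ ^ p.toReal ≤ ‖∑ i ∈ s, ε i • u i‖ ^ p.toReal := by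
  classical
  have hr : 2 ≤ p.toReal := by simpa using ENNReal.toReal_mono hp hp2
  induction s using Finset.induction_on with
  | empty =>
    exact ⟨fun _ => 1, fun _ => Or.inl rfl, by simp [Real.zero_rpow (by linarith : p.toReal ≠ 0)]⟩
  | insert a s ha ih =>
    obtain ⟨ε, hε, h⟩ := ih
    have hcl := Lp.two_mul_rpow_add_rpow_le hp2 hp (∑ i ∈ s, ε i • u i) (u a)
    have key : ∀ σ : 𝕜, ∑ i ∈ insert a s, Function.update ε a σ i • u i =
        σ • u a + ∑ i ∈ s, ε i • u i := by
      intro σ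
      rw [Finset.sum_insert ha, Function.update_self]
      congr 1
      exact Finset.sum_congr rfl fun i hi => by
        rw [Function.update_of_ne (ne_of_mem_of_not_mem hi ha)]
    have hup : ∀ σ : 𝕜, (σ = 1 ∨ σ = -1) →
        ∀ i, Function.update ε a σ i = 1 ∨ Function.update ε a σ i = -1 := by
      intro σ hσ i
      rcases eq_or_ne i a with rfl | hi
      · simpa using hσ
      · simpa [hi] using hε i
    rw [Finset.sum_insert ha]
    rcases le_total (‖∑ i ∈ s, ε i • u i - u a‖ ^ p.toReal)
      (‖∑ i ∈ s, ε i • u i + u a‖ ^ p.toReal) with hc | hc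
    · refine ⟨Function.update ε a 1, hup 1 (Or.inl rfl), ?_⟩
      rw [key, one_smul, add_comm (u a)]
      linarith
    · refine ⟨Function.update ε a (-1), hup (-1) (Or.inr rfl), ?_⟩
      rw [key, neg_one_smul, neg_add_eq_sub]
      linarith

/-- Functions whose supports overlap at most `N` times satisfy an upper `p`-estimate. The supports
are only required up to null sets, and `A i` need not be measurable. -/
theorem Lp.norm_sum_rpow_le_of_overlap [Fact (1 ≤ p)] (hp : p ≠ ∞) {ι : Type*}
    (y : ι → Lp 𝕜 p μ) (A : ι → Set α) (hA : ∀ i, ∀ᵐ x ∂μ, x ∉ A i → y i x = 0) (N : ℕ)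
    (s : Finset ι) (hN : ∀ x, ∃ t ⊆ s, t.card ≤ N ∧ ∀ i ∈ s, x ∈ A i → i ∈ t) :
    ‖∑ i ∈ s, y i‖ ^ p.toReal ≤ (N : ℝ) ^ (p.toReal - 1) * ∑ i ∈ s, ‖y i‖ ^ p.toReal := by
  have hp1 : (1 : ℝ≥0∞) ≤ p := Fact.out
  have hp0 : p ≠ 0 := (lt_of_lt_of_le one_pos hp1).ne'
  have hr : 1 ≤ p.toReal := by simpa using ENNReal.toReal_mono hp hp1
  have hNn : 0 ≤ (N : ℝ) ^ (p.toReal - 1) := by positivity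
  rw [← ENNReal.ofReal_le_ofReal_iff (by positivity), ENNReal.ofReal_mul hNn,
    ENNReal.ofReal_sum_of_nonneg (fun i _ => by positivity)]
  simp only [Lp.ofReal_norm_rpow_eq_lintegral hp0 hp]
  have hmeas : ∀ w : Lp 𝕜 p μ, AEMeasurable (fun x => ENNReal.ofReal (‖w x‖ ^ p.toReal)) μ :=
    fun w => ((Lp.aestronglyMeasurable w).norm.aemeasurable.pow_const _).ennreal_ofReal
  rw [← lintegral_finsetSum' _ (fun i _ => hmeas (y i)),
    ← lintegral_const_mul' _ _ ENNReal.ofReal_ne_top]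
  refine lintegral_mono_ae ?_
  have hall : ∀ᵐ x ∂μ, ∀ i ∈ s, x ∉ A i → y i x = 0 :=
    (Filter.eventually_all_finset s).2 fun i _ => hA i
  filter_upwards [hall, Lp.coeFn_finsetSum s y] with x hx hsum
  obtain ⟨t, hts, htN, ht⟩ := hN x
  have hzero : ∀ i ∈ s, i ∉ t → y i x = 0 := fun i hi hit => hx i hi fun h => hit (ht i hi h)
  rw [hsum, ← ENNReal.ofReal_sum_of_nonneg (fun i _ => by positivity),
    ← ENNReal.ofReal_mul hNn]
  refine ENNReal.ofReal_le_ofReal ?_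
  rw [Finset.sum_apply, ← Finset.sum_subset hts hzero]
  calc ‖∑ i ∈ t, y i x‖ ^ p.toReal ≤ (∑ i ∈ t, ‖y i x‖) ^ p.toReal := by
        gcongr
        exact norm_sum_le _ _
    _ ≤ (t.card : ℝ) ^ (p.toReal - 1) * ∑ i ∈ t, ‖y i x‖ ^ p.toReal :=
        Real.rpow_sum_le_const_mul_sum_rpow_of_nonneg _ hr fun i _ => norm_nonneg _
    _ ≤ (N : ℝ) ^ (p.toReal - 1) * ∑ i ∈ s, ‖y i x‖ ^ p.toReal := by
        gcongr

end LpEstimates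

/-! ### Translates -/

/-- A `δ`-separated set of reals has boundedly many points in the translates of `[-M, M]`. -/
theorem exists_card_le_of_separated {Λ : Set ℝ} {δ : ℝ} (hδ : 0 < δ)
    (hsep : ∀ t ∈ Λ, ∀ u ∈ Λ, |t - u| < δ → t = u) (M : ℝ) :
    ∃ N : ℕ, ∀ (s : Finset Λ) (x : ℝ), (∀ t ∈ s, |x - t| ≤ M) → s.card ≤ N := by
  refine ⟨(Finset.Icc ⌊-M / δ⌋ ⌊M / δ⌋).card, fun s x hs => ?_⟩
  refine Finset.card_le_card_of_injOn (fun t : Λ => ⌊(x - t) / δ⌋) (fun t ht => ?_) ?_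
  · have := abs_le.1 (hs t ht)
    simp only [Finset.coe_Icc, Set.mem_Icc]
    exact ⟨Int.floor_mono (by gcongr; exact this.1), Int.floor_mono (by gcongr; exact this.2)⟩
  · intro t _ u _ htu
    have h := Int.abs_sub_lt_one_of_floor_eq_floor htu
    rw [← sub_div, abs_div, abs_of_pos hδ, div_lt_one hδ] at h
    refine Subtype.ext (hsep t t.2 u u.2 ?_)
    rwa [sub_sub_sub_cancel_left, abs_sub_comm] at h

section Translation

variable {𝕜 : Type*} [RCLike 𝕜] {p : ℝ≥0∞}

theorem norm_lpTranslate (t : ℝ) (f : Lp 𝕜 p (volume : Measure ℝ)) : ‖lpTranslate t f‖ = ‖f‖ :=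
  Lp.norm_compMeasurePreserving _ _

theorem lpTranslate_sub (t : ℝ) (f g : Lp 𝕜 p (volume : Measure ℝ)) :
    lpTranslate t (f - g) = lpTranslate t f - lpTranslate t g :=
  map_sub (Lp.compMeasurePreserving (fun x : ℝ => x - t)
    (measurePreserving_sub_right (volume : Measure ℝ) t)) f g

theorem lpTranslate_add (t u : ℝ) (f : Lp 𝕜 p (volume : Measure ℝ)) :
    lpTranslate (t + u) f = lpTranslate t (lpTranslate u f) := by
  unfold lpTranslate
  rw [← Lp.compMeasurePreserving_comp_apply]
  simp only [Function.comp_def, sub_sub]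

theorem lpTranslate_zero (f : Lp 𝕜 p (volume : Measure ℝ)) : lpTranslate 0 f = f := by
  unfold lpTranslate
  simp only [sub_zero]
  exact Lp.compMeasurePreserving_id_apply f

theorem continuous_lpTranslate [Fact (1 ≤ p)] (hp : p ≠ ∞) (f : Lp 𝕜 p (volume : Measure ℝ)) :
    Continuous fun t : ℝ => lpTranslate t f := by
  let g : C(ℝ × ℝ, ℝ) := ⟨fun z => z.2 - z.1, by fun_prop⟩
  exact Continuous.compMeasurePreservingLp (continuous_const (y := f)) g.curry.continuous
    (fun t => measurePreserving_sub_right (volume : Measure ℝ) t) hp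

/-- If distinct translates of `f` are uniformly apart in norm, the translation parameters are
uniformly apart in `ℝ`. -/
theorem exists_separated_of_norm_sub_ge [Fact (1 ≤ p)] (hp : p ≠ ∞)
    (f : Lp 𝕜 p (volume : Measure ℝ)) {Λ : Set ℝ} {η : ℝ} (hη : 0 < η)
    (h : ∀ t ∈ Λ, ∀ u ∈ Λ, t ≠ u → η ≤ ‖lpTranslate t f - lpTranslate u f‖) :
    ∃ δ > 0, ∀ t ∈ Λ, ∀ u ∈ Λ, |t - u| < δ → t = u := by
  obtain ⟨δ, hδ, hcont⟩ := Metric.continuous_iff.1 (continuous_lpTranslate hp f) 0 η hη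
  refine ⟨δ, hδ, fun t ht u hu htu => ?_⟩
  by_contra hne
  have h1 := hcont (t - u) (by simpa [Real.dist_eq] using htu)
  have h2 : lpTranslate t f = lpTranslate u (lpTranslate (t - u) f) := by
    rw [← lpTranslate_add, add_sub_cancel]
  have h3 := h t ht u hu hne
  rw [h2, ← lpTranslate_sub, norm_lpTranslate] at h3
  rw [lpTranslate_zero, dist_eq_norm] at h1
  linarith

/-- Functions of bounded support are dense in `L_p(ℝ)`, `p < ∞`. -/
theorem exists_bounded_support_approx [Fact (1 ≤ p)] (hp : p ≠ ∞)
    (f : Lp 𝕜 p (volume : Measure ℝ)) {η : ℝ} (hη : 0 < η) :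
    ∃ (g : Lp 𝕜 p (volume : Measure ℝ)) (M : ℝ),
      ‖f - g‖ ≤ η ∧ ∀ᵐ x, M < |x| → g x = 0 := by
  obtain ⟨g, hsupp, hg, -, hmem⟩ := (Lp.memLp f).exists_hasCompactSupport_eLpNorm_sub_le hp
    (ε := ENNReal.ofReal η) (by simpa using hη)
  obtain ⟨M, hM⟩ := hsupp.isCompact.isBounded.subset_closedBall (0 : ℝ)
  refine ⟨hmem.toLp g, M, ?_, ?_⟩
  · rw [Lp.norm_def]
    refine ENNReal.toReal_le_of_le_ofReal hη.le (le_trans (le_of_eq (eLpNorm_congr_ae ?_)) hg)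
    filter_upwards [Lp.coeFn_sub f (hmem.toLp g), hmem.coeFn_toLp] with x h1 h2
    rw [h1, Pi.sub_apply, Pi.sub_apply, h2]
  · filter_upwards [hmem.coeFn_toLp] with x hx hMx
    rw [hx]
    by_contra hne
    have := hM (subset_tsupport g (Function.mem_support.2 hne))
    rw [Metric.mem_closedBall, Real.dist_eq, sub_zero] at this
    linarith

theorem lpTranslate_ae_eq_zero {g : Lp 𝕜 p (volume : Measure ℝ)} {M : ℝ}
    (hg : ∀ᵐ x, M < |x| → g x = 0) (t : ℝ) :
    ∀ᵐ x, M < |x - t| → lpTranslate t g x = 0 := by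
  have hmp := measurePreserving_sub_right (volume : Measure ℝ) t
  filter_upwards [Lp.coeFn_compMeasurePreserving g hmp, hmp.quasiMeasurePreserving.ae hg]
    with x h1 h2 hM
  unfold lpTranslate
  rw [h1]
  exact h2 hM

end Translation

/-! ### Unconditional bases -/

/-- Sign changes and restrictions of the basis expansion are uniformly bounded. -/
theorem UnconditionalSchauderBasis.exists_norm_signed_sum_le {ι 𝕜 X : Type*} [RCLike 𝕜]
    [NormedAddCommGroup X] [NormedSpace 𝕜 X] [CompleteSpace X]
    (b : UnconditionalSchauderBasis ι 𝕜 X) :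
    ∃ K : ℝ, 0 < K ∧ ∀ (s : Finset ι) (ε : ι → 𝕜), (∀ i, ε i = 1 ∨ ε i = -1) → ∀ x : X,
      ‖∑ i ∈ s, ε i • b.coord i x • b.basis i‖ ≤ K * ‖x‖ := by
  classical
  obtain ⟨C, hC⟩ := UnconditionalSchauderBasis.exists_norm_proj_le b
  have hC0 : 0 ≤ C := (norm_nonneg _).trans (hC ∅)
  refine ⟨2 * C + 1, by linarith, fun s ε hε x => ?_⟩
  have hb : ∀ A : Finset ι, ‖∑ i ∈ A, b.coord i x • b.basis i‖ ≤ C * ‖x‖ := fun A => by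
    rw [← b.proj_apply A x]
    exact (b.proj A).le_of_opNorm_le (hC A) x
  rw [← Finset.sum_filter_add_sum_filter_not s (fun i => ε i = 1)]
  have h1 : ∑ i ∈ s with ε i = 1, ε i • b.coord i x • b.basis i =
      ∑ i ∈ s with ε i = 1, b.coord i x • b.basis i :=
    Finset.sum_congr rfl fun i hi => by rw [(Finset.mem_filter.1 hi).2, one_smul]
  have h2 : ∑ i ∈ s with ¬ε i = 1, ε i • b.coord i x • b.basis i =
      -∑ i ∈ s with ¬ε i = 1, b.coord i x • b.basis i := by
    rw [← Finset.sum_neg_distrib]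
    exact Finset.sum_congr rfl fun i hi => by
      rw [(hε i).resolve_left (Finset.mem_filter.1 hi).2, neg_one_smul]
  rw [h1, h2]
  refine (norm_add_le _ _).trans ?_
  rw [norm_neg]
  linarith [hb {i ∈ s | ε i = 1}, hb {i ∈ s | ¬ε i = 1}, norm_nonneg x]

/-- Diagonal comparison: let `P` be bounded with values in the space `X` of the unconditional basis
`b`, and let `y` be a family on which the coordinates of `P` are `1` along the
diagonal. Then, up to a constant and a choice of signs, `b` is dominated by `y`. -/
theorem UnconditionalSchauderBasis.exists_norm_sum_le_of_diagonal {ι 𝕜 E X : Type*} [RCLike 𝕜]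
    [NormedAddCommGroup E] [NormedSpace 𝕜 E] [NormedAddCommGroup X] [NormedSpace 𝕜 X]
    (b : UnconditionalSchauderBasis ι 𝕜 X) {K : ℝ}
    (hK : ∀ (s : Finset ι) (ε : ι → 𝕜), (∀ i, ε i = 1 ∨ ε i = -1) → ∀ x : X,
      ‖∑ i ∈ s, ε i • b.coord i x • b.basis i‖ ≤ K * ‖x‖)
    (P : E →L[𝕜] X) (y : ι → E) (hy : ∀ i, b.coord i (P (y i)) = 1)
    (s : Finset ι) (a : ι → 𝕜) :
    ∃ ε : ι → 𝕜, (∀ i, ε i = 1 ∨ ε i = -1) ∧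
      ‖∑ i ∈ s, a i • b.basis i‖ ≤ K * ‖P (∑ i ∈ s, (ε i * a i) • y i)‖ := by
  obtain ⟨ε, hε, h⟩ := exists_signs_norm_add_diagonal_le 𝕜
    (fun i j => (a j * b.coord i (P (y j))) • b.basis i) s 0
  refine ⟨ε, hε, ?_⟩
  simp only [zero_add, hy, mul_one] at h
  refine h.trans (le_trans (le_of_eq ?_) (hK s ε hε _))
  congr 1
  refine Finset.sum_congr rfl fun i _ => ?_
  simp only [map_sum, map_smul, smul_eq_mul, Finset.sum_smul, Finset.smul_sum, smul_smul]
  refine Finset.sum_congr rfl fun j _ => ?_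
  congr 1
  ring

/-! ### Equivalence with the unit vector basis -/

theorem norm_sum_smul_unitVector_rpow {𝕜 ι : Type*} [RCLike 𝕜] {p : ℝ≥0∞} [Fact (1 ≤ p)]
    (hp : 0 < p.toReal) (s : Finset ι) (a : ι → 𝕜) :
    ‖∑ i ∈ s, a i • unitVector 𝕜 p i‖ ^ p.toReal = ∑ i ∈ s, ‖a i‖ ^ p.toReal := by
  classical
  rw [← lp.norm_sum_single (E := fun _ : ι => 𝕜) hp a s]
  congr 2
  refine Finset.sum_congr rfl fun i _ => ?_
  unfold unitVector
  rw [← lp.single_smul, smul_eq_mul, mul_one]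

/-- An upper `ℓ_p`-estimate for the translates of a function of bounded support along a
separated set. -/
theorem exists_norm_sum_smul_lpTranslate_le {𝕜 : Type*} [RCLike 𝕜] {p : ℝ≥0∞} [Fact (1 ≤ p)]
    (hp : p ≠ ∞) {g : Lp 𝕜 p (volume : Measure ℝ)} {M : ℝ} (hg : ∀ᵐ x, M < |x| → g x = 0)
    {Λ : Set ℝ} {δ : ℝ} (hδ : 0 < δ) (hsep : ∀ t ∈ Λ, ∀ u ∈ Λ, |t - u| < δ → t = u) :
    ∃ C : ℝ, 0 ≤ C ∧ ∀ (s : Finset Λ) (a : Λ → 𝕜),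
      ‖∑ t ∈ s, a t • lpTranslate (t : ℝ) g‖ ≤ C * ‖∑ t ∈ s, a t • unitVector 𝕜 p t‖ := by
  have hr : 1 ≤ p.toReal := by simpa using ENNReal.toReal_mono hp (Fact.out : 1 ≤ p)
  have hr0 : 0 < p.toReal := by linarith
  obtain ⟨N, hN⟩ := exists_card_le_of_separated hδ hsep M
  refine ⟨(N + 1) * ‖g‖, by positivity, fun s a => ?_⟩
  have hsupp : ∀ t : Λ, ∀ᵐ x, x ∉ {x : ℝ | |x - t| ≤ M} →
      (a t • lpTranslate (t : ℝ) g : Lp 𝕜 p (volume : Measure ℝ)) x = 0 := by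
    intro t
    filter_upwards [Lp.coeFn_smul (a t) (lpTranslate (t : ℝ) g),
      lpTranslate_ae_eq_zero hg (t : ℝ)] with x h1 h2 hx
    rw [h1, Pi.smul_apply, h2 (not_le.1 hx), smul_zero]
  have hov := Lp.norm_sum_rpow_le_of_overlap hp (fun t : Λ => a t • lpTranslate (t : ℝ) g)
    (fun t => {x : ℝ | |x - t| ≤ M}) hsupp N s fun x =>
      ⟨{t ∈ s | |x - t| ≤ M}, Finset.filter_subset _ _,
        hN _ x fun t ht => (Finset.mem_filter.1 ht).2,
        fun t ht hx => Finset.mem_filter.2 ⟨ht, hx⟩⟩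
  have hNr : (N : ℝ) ^ (p.toReal - 1) ≤ ((N : ℝ) + 1) ^ p.toReal :=
    (Real.rpow_le_rpow (by positivity) (by linarith) (by linarith)).trans
      (Real.rpow_le_rpow_of_exponent_le (by simp) (by linarith))
  have hsum : ∑ t ∈ s, ‖a t • lpTranslate (t : ℝ) g‖ ^ p.toReal =
      (‖g‖ * ‖∑ t ∈ s, a t • unitVector 𝕜 p t‖) ^ p.toReal := by
    rw [Real.mul_rpow (norm_nonneg _) (norm_nonneg _), norm_sum_smul_unitVector_rpow hr0,
      Finset.mul_sum]
    exact Finset.sum_congr rfl fun t _ => by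
      rw [norm_smul, norm_lpTranslate, mul_comm, Real.mul_rpow (norm_nonneg _) (norm_nonneg _)]
  rw [← Real.rpow_le_rpow_iff (norm_nonneg _) (by positivity) hr0, mul_assoc,
    Real.mul_rpow (by positivity) (by positivity), ← hsum]
  exact hov.trans (mul_le_mul_of_nonneg_right hNr
    (Finset.sum_nonneg fun t _ => Real.rpow_nonneg (norm_nonneg _) _))

theorem theoremT {𝕜 : Type*} [RCLike 𝕜] {p : ℝ≥0∞} [Fact (1 ≤ p)]
    (hp : 2 < p) (hp_top : p < ∞)
    (f : Lp 𝕜 p (volume : Measure ℝ)) (Λ : Set ℝ)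
    (hbasis : IsUnconditionalBasisOf (fun t : Λ => lpTranslate (t : ℝ) f) (translateSpan f Λ))
    (hcompl : (translateSpan f Λ).ClosedComplemented) :
    EquivalentFamilies 𝕜 (fun t : Λ => lpTranslate (t : ℝ) f)
      (fun t : Λ => unitVector 𝕜 p t) := by
  classical
  rcases isEmpty_or_nonempty Λ with hemp | ⟨⟨t₀⟩⟩
  · exact ⟨1, 1, one_pos, one_pos, fun s a => by simp [Finset.eq_empty_of_isEmpty s]⟩
  obtain ⟨b, hb⟩ := hbasis
  replace hb : ∀ t : Λ, (b.basis t : Lp 𝕜 p (volume : Measure ℝ)) = lpTranslate (t : ℝ) f := hb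
  obtain ⟨P, hP⟩ := hcompl
  have hp2 : 2 ≤ p := hp.le
  have hpt : p ≠ ∞ := hp_top.ne
  have hr : 2 ≤ p.toReal := by simpa using ENNReal.toReal_mono hpt hp2
  have hr0 : 0 < p.toReal := by linarith
  have : CompleteSpace (translateSpan f Λ) :=
    (Submodule.isClosed_topologicalClosure _).completeSpace_coe
  obtain ⟨K, hK0, hK⟩ := UnconditionalSchauderBasis.exists_norm_signed_sum_le b
  have hnb : ∀ t, ‖b.basis t‖ = ‖f‖ := fun t => by
    rw [← norm_lpTranslate (t : ℝ) f, ← hb t, Submodule.coe_norm]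
  have hcoord : ∀ t x, ‖b.coord t x‖ * ‖f‖ ≤ K * ‖x‖ := fun t x => by
    have := hK {t} (fun _ => 1) (fun _ => Or.inl rfl) x
    simpa [norm_smul, hnb] using this
  have hself : ∀ t, b.coord t (b.basis t) = 1 := fun t => by simp [b.ortho]
  have hother : ∀ t u, t ≠ u → b.coord t (b.basis u) = 0 := fun t u h => by
    simp [b.ortho, h]
  -- Biorthogonality rules out `f = 0`, as `Λ` has a point.
  have hf : 0 < ‖f‖ := by
    rw [← hnb t₀, norm_pos_iff]
    intro h0
    have := hself t₀
    rw [h0, map_zero] at this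
    exact zero_ne_one this
  have hcoe : ∀ (s : Finset Λ) (a : Λ → 𝕜),
      ‖∑ t ∈ s, a t • lpTranslate (t : ℝ) f‖ = ‖∑ t ∈ s, a t • b.basis t‖ := fun s a => by
    rw [Submodule.coe_norm]
    simp [hb]
  obtain ⟨δ, hδ, hsep⟩ : ∃ δ > 0, ∀ t ∈ Λ, ∀ u ∈ Λ, |t - u| < δ → t = u := by
    refine exists_separated_of_norm_sub_ge hpt f (div_pos hf hK0) fun t ht u hu hne => ?_
    have h := hcoord ⟨t, ht⟩ (b.basis ⟨t, ht⟩ - b.basis ⟨u, hu⟩)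
    rw [map_sub, hself, hother _ _ (by simpa using hne), sub_zero, norm_one, one_mul,
      Submodule.coe_norm, Submodule.coe_sub, hb, hb] at h
    rwa [div_le_iff₀' hK0]
  -- The error `f - g` moves the coordinates `b.coord t (P (T_t f)) = 1` by at most `1 / 2`.
  obtain ⟨g, M, hfg, hg⟩ := exists_bounded_support_approx hpt f
    (η := ‖f‖ / (2 * (K * (‖P‖ + 1)))) (by positivity)
  obtain ⟨C, hC0, hC⟩ := exists_norm_sum_smul_lpTranslate_le hpt hg hδ hsep
  set G : Λ → 𝕜 := fun t => b.coord t (P (lpTranslate (t : ℝ) g)) with hG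
  have hGhalf : ∀ t, 1 / 2 ≤ ‖G t‖ := by
    intro t
    have hPt : P (lpTranslate (t : ℝ) f) = b.basis t := by rw [← hb t, hP]
    have h1 : 1 - G t = b.coord t (P (lpTranslate (t : ℝ) (f - g))) := by
      rw [lpTranslate_sub, map_sub, map_sub, hPt, hself]
    have h2 := hcoord t (P (lpTranslate (t : ℝ) (f - g)))
    have h3 := P.le_opNorm (lpTranslate (t : ℝ) (f - g))
    rw [norm_lpTranslate] at h3
    have h4 : K * ((‖P‖ + 1) * ‖f - g‖) ≤ ‖f‖ / 2 := by
      rw [le_div_iff₀ (by positivity)] at hfg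
      linarith
    have h5 : ‖1 - G t‖ * ‖f‖ ≤ 1 / 2 * ‖f‖ := by
      rw [h1]
      calc _ ≤ K * (‖P‖ * ‖f - g‖) := h2.trans (by gcongr)
        _ ≤ K * ((‖P‖ + 1) * ‖f - g‖) := by gcongr; linarith
        _ ≤ _ := by linarith
    have h6 := le_of_mul_le_mul_right h5 hf
    have h7 := norm_sub_norm_le (1 : 𝕜) (1 - G t)
    rw [norm_one, sub_sub_cancel] at h7
    linarith
  set y : Λ → Lp 𝕜 p (volume : Measure ℝ) := fun t => (G t)⁻¹ • lpTranslate (t : ℝ) g with hy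
  have hGne : ∀ t, G t ≠ 0 := fun t h => by
    have := hGhalf t
    rw [h, norm_zero] at this
    linarith
  have hdiag : ∀ t, b.coord t (P (y t)) = 1 := fun t => by
    rw [hy, map_smul, map_smul, smul_eq_mul]
    exact inv_mul_cancel₀ (hGne t)
  -- The summand `1` only makes the upper constant positive when `P` or `C` vanishes.
  refine ⟨‖f‖ / K, K * (‖P‖ * (C * 2)) + 1, by positivity, by positivity,
    fun s a => ⟨?_, ?_⟩⟩
  · obtain ⟨ε, hε, h⟩ :=
      Lp.exists_signs_sum_rpow_le hp2 hpt (fun t : Λ => a t • lpTranslate (t : ℝ) f) s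
    have h1 : ∑ t ∈ s, ‖a t • lpTranslate (t : ℝ) f‖ ^ p.toReal =
        (‖∑ t ∈ s, a t • unitVector 𝕜 p t‖ * ‖f‖) ^ p.toReal := by
      rw [Real.mul_rpow (norm_nonneg _) (norm_nonneg _), norm_sum_smul_unitVector_rpow hr0,
        Finset.sum_mul]
      exact Finset.sum_congr rfl fun t _ => by
        rw [norm_smul, norm_lpTranslate, Real.mul_rpow (norm_nonneg _) (norm_nonneg _)]
    rw [h1, Real.rpow_le_rpow_iff (by positivity) (by positivity) hr0] at h
    have h2 := hK s ε hε (∑ t ∈ s, a t • b.basis t)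
    have h3 : ∀ t ∈ s, b.coord t (∑ u ∈ s, a u • b.basis u) = a t := fun t ht => by
      rw [map_sum, Finset.sum_eq_single t]
      · rw [map_smul, hself, smul_eq_mul, mul_one]
      · intro u _ hut
        rw [map_smul, hother _ _ hut.symm, smul_zero]
      · exact fun h => absurd ht h
    rw [Finset.sum_congr rfl fun t ht => by rw [h3 t ht, smul_smul], ← hcoe, ← hcoe] at h2
    simp only [smul_smul] at h
    rw [div_mul_eq_mul_div, div_le_iff₀' hK0, mul_comm ‖f‖]
    exact h.trans h2
  · obtain ⟨ε, hε, h⟩ :=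
      UnconditionalSchauderBasis.exists_norm_sum_le_of_diagonal b hK P y hdiag s a
    have hεn : ∀ t, ‖ε t‖ = 1 := fun t => by
      rcases hε t with h | h <;> simp [h]
    have hbound : ‖∑ t ∈ s, (ε t * a t) • y t‖ ≤
        C * 2 * ‖∑ t ∈ s, a t • unitVector 𝕜 p t‖ := by
      have h1 : ∀ t, ‖ε t * a t * (G t)⁻¹‖ ≤ 2 * ‖a t‖ := fun t => by
        rw [norm_mul, norm_mul, hεn, one_mul, norm_inv, mul_comm]
        gcongr
        rw [inv_le_comm₀ (by linarith [hGhalf t]) two_pos]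
        linarith [hGhalf t]
      have h2 := hC s fun t => ε t * a t * (G t)⁻¹
      simp only [hy, smul_smul]
      rw [mul_assoc]
      refine h2.trans (mul_le_mul_of_nonneg_left ?_ hC0)
      rw [← Real.rpow_le_rpow_iff (norm_nonneg _) (by positivity) hr0,
        Real.mul_rpow two_pos.le (norm_nonneg _), norm_sum_smul_unitVector_rpow hr0,
        norm_sum_smul_unitVector_rpow hr0, Finset.mul_sum]
      refine Finset.sum_le_sum fun t _ => ?_
      rw [← Real.mul_rpow two_pos.le (norm_nonneg _)]
      exact Real.rpow_le_rpow (norm_nonneg _) (h1 t) hr0.le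
    rw [hcoe]
    calc _ ≤ K * ‖P (∑ t ∈ s, (ε t * a t) • y t)‖ := h
      _ ≤ K * (‖P‖ * (C * 2 * ‖∑ t ∈ s, a t • unitVector 𝕜 p t‖)) :=
          mul_le_mul_of_nonneg_left ((P.le_opNorm _).trans
            (mul_le_mul_of_nonneg_left hbound P.opNorm_nonneg)) hK0.le
      _ ≤ _ := by
          linarith [norm_nonneg (∑ t ∈ s, a t • unitVector 𝕜 p t)]
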